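/- All logarithms $\log$ are to the base $2$. For a positive integer $d$, the hypercube $Q_d$ is the graph whose vertices are the $d$-bit binary strings, two strings being adjacent if and only if they differ at exactly one position. A permutation of a finite set $V$ is a bijection $V\to\{1,\dots,|V|\}$; it separates two disjoint sets $A,B\subseteq V$ if every element of one of them precedes every element of the other. The separation dimension $\pi(G)$ of a finite graph $G$ is the cardinality of a smallest family $\mathcal F$ of permutations of $V(G)$ such that every two disjoint edges of $G$ are separated by some member of $\mathcal F$. **Theorem.** For every integer $d\ge 3$, $$\pi(Q_d)\ \ge\ \tfrac12\,\bigl\lfloor \log\log(d-1)\bigr\rfloor ,$$ and there is a function $\varepsilon:\mathbb N\to\mathbb R$ with $\varepsilon(d)\to 0$ as $d\to\infty$ such that, for every integer $d\ge 3$, $$\pi(Q_d)\ \le\ \Bigl\lceil \log\log d+\tfrac12\log\log\log d+\log\sqrt{2\pi}+\varepsilon(d)\Bigr\rceil ,$$ where $\pi$ under the square root is the circle constant. -/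

import Mathlib

open Filter Topology

/-- A permutation of a finite set `V`: a bijection from `V` to `[|V|]`. -/
abbrev VertexPerm (V : Type*) [Fintype V] : Type _ :=
  V ≃ Fin (Fintype.card V)

/-- Every element of `A` precedes every element of `B` in `σ`. -/
def Precedes {V : Type*} [Fintype V] (σ : VertexPerm V) (A B : Finset V) : Prop :=
  ∀ a ∈ A, ∀ b ∈ B, σ a < σ b

/-- `σ` separates `A` and `B`. -/
def Separates {V : Type*} [Fintype V] (σ : VertexPerm V) (A B : Finset V) : Prop :=
  Precedes σ A B ∨ Precedes σ B A

/-- The family `F` is pairwise suitable for the hypergraph with vertex set `V` and edge set `E`: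
any two disjoint edges are separated by some member of `F`. -/
def IsPairwiseSuitable {V : Type*} [Fintype V]
    (F : Finset (VertexPerm V)) (E : Set (Finset V)) : Prop :=
  ∀ e ∈ E, ∀ f ∈ E, e ≠ f → Disjoint e f → ∃ σ ∈ F, Separates σ e f

/-- The separation dimension of the hypergraph with vertex set `V` and edge set `E`: the cardinality
of a smallest family of permutations of `V` that is pairwise suitable for it. -/
noncomputable def separationDimension {V : Type*} [Fintype V] (E : Set (Finset V)) : ℕ :=
  sInf {k : ℕ | ∃ F : Finset (VertexPerm V), IsPairwiseSuitable F E ∧ F.card = k}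

/-- The edges of a graph as two-element sets of vertices, i.e. the graph as a `2`-uniform
hypergraph. -/
def graphEdges {V : Type*} [DecidableEq V] (G : SimpleGraph V) : Set (Finset V) :=
  {e | ∃ u v : V, G.Adj u v ∧ e = {u, v}}

/-- The `d`-dimensional hypercube: binary strings of length `d`, two of them adjacent when they
differ at exactly one position. -/
def hypercube (d : ℕ) : SimpleGraph (Fin d → Bool) where
  Adj u v := ∃! i, u i ≠ v i
  symm := ⟨fun _ _ ⟨i, hi, h⟩ => ⟨i, hi.symm, fun j hj => h j hj.symm⟩⟩
  loopless := ⟨fun _ ⟨_, hi, _⟩ => hi rfl⟩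

/-!
Lower bound: `Q_d` contains the full subdivision of `K_d`. By iterated Erdős–Szekeres, all `p`
orders of a pairwise suitable family are monotone on some `2 ^ 2 ^ p + 2` of the `d` vertices of
`K_d` once `d > (2 ^ 2 ^ p + 1) ^ 2 ^ p`, and reversing an order does not change what it separates,
so they may be taken increasing on vertices `c 0, …, c N`. Colour a pair `i < j` by the set of
orders that put the subdivision vertex of `{c i, c (j + 1)}` above `c j`. An order separating the
edges from `c j` to `{c j, c (k + 1)}` and from `c (j + 1)` to `{c i, c (j + 1)}` lies in the colour
of `(i, j)` but not in that of `(j, k)`. So the `2 ^ p` colours properly colour a shift graph, which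
forces `N ≤ 2 ^ 2 ^ p`.

Upper bound: two disjoint edges of `Q_d` in directions `i` and `j` differ in a coordinate `l`
outside `{i, j}`, and the lexicographic order that reads the coordinates in an order placing `l`
before `i` and `j` separates them. Following Spencer, `m + 1` orders of `[d]` provide such an order
for all `l, i, j` whenever `d ≤ 2 ^ C(m, r)` with `2 r < m`; Wallis' product bounds `C(m, r)` below.
-/

/-! ### Families of vertex orders -/

section VertexOrders

variable {V W : Type*} [Fintype V] [Fintype W]

theorem exists_vertexPerm_lt_iff {α : Type*} [LinearOrder α] {f : V → α}
    (hf : Function.Injective f) :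
    ∃ σ : VertexPerm V, ∀ v w, σ v < σ w ↔ f v < f w := by
  let : LinearOrder V := LinearOrder.lift' f hf
  exact ⟨(Fintype.orderIsoFinOfCardEq V rfl).symm.toEquiv,
    fun v w => (Fintype.orderIsoFinOfCardEq V rfl).symm.lt_iff_lt⟩

theorem exists_precedes_of_disjoint {A B : Finset V} (h : Disjoint A B) :
    ∃ σ : VertexPerm V, Precedes σ A B := by
  classical
  obtain ⟨σ, hσ⟩ := exists_vertexPerm_lt_iff
    (f := fun v => toLex (decide (v ∉ A), Fintype.equivFin V v)) fun v w hvw =>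
      (Fintype.equivFin V).injective (congrArg Prod.snd (toLex.injective hvw))
  refine ⟨σ, fun a ha b hb => (hσ a b).2 (Prod.Lex.toLex_lt_toLex.2 (Or.inl ?_))⟩
  simp [ha, Finset.disjoint_right.1 h hb]

theorem separationDimension_le_card {E : Set (Finset V)} {F : Finset (VertexPerm V)}
    (hF : IsPairwiseSuitable F E) : separationDimension E ≤ F.card :=
  Nat.sInf_le ⟨F, hF, rfl⟩

theorem exists_isPairwiseSuitable_card_eq_separationDimension (E : Set (Finset V)) :
    ∃ F : Finset (VertexPerm V), IsPairwiseSuitable F E ∧ F.card = separationDimension E := by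
  classical
  have huniv : IsPairwiseSuitable (Finset.univ : Finset (VertexPerm V)) E :=
    fun e _ f _ _ hdisj =>
      let ⟨σ, hσ⟩ := exists_precedes_of_disjoint hdisj
      ⟨σ, Finset.mem_univ σ, Or.inl hσ⟩
  exact Nat.sInf_mem (s := {k | ∃ F : Finset (VertexPerm V), IsPairwiseSuitable F E ∧ F.card = k})
    ⟨_, Finset.univ, huniv, rfl⟩

theorem separationDimension_le_of_embedding (φ : V ↪ W) {E : Set (Finset V)}
    {E' : Set (Finset W)} (hφ : ∀ e ∈ E, e.map φ ∈ E') :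
    separationDimension E ≤ separationDimension E' := by
  classical
  obtain ⟨F, hF, hcard⟩ := exists_isPairwiseSuitable_card_eq_separationDimension E'
  choose pullback hpullback using fun σ : VertexPerm W =>
    exists_vertexPerm_lt_iff (σ.injective.comp φ.injective)
  have hsuitable : IsPairwiseSuitable (F.image pullback) E := by
    intro e he f hf hne hdisj
    obtain ⟨σ, hσ, hsep⟩ := hF _ (hφ e he) _ (hφ f hf) ((Finset.map_injective φ).ne hne)
      ((Finset.disjoint_map φ).2 hdisj)
    refine ⟨pullback σ, Finset.mem_image_of_mem _ hσ, ?_⟩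
    simpa [Separates, Precedes, hpullback] using hsep
  calc separationDimension E ≤ (F.image pullback).card := separationDimension_le_card hsuitable
    _ ≤ F.card := Finset.card_image_le
    _ = separationDimension E' := hcard

theorem separationDimension_graphEdges_le_of_isContained [DecidableEq V] [DecidableEq W]
    {G : SimpleGraph V} {H : SimpleGraph W} (h : G.IsContained H) :
    separationDimension (graphEdges G) ≤ separationDimension (graphEdges H) := by
  obtain ⟨φ⟩ := h
  refine separationDimension_le_of_embedding φ.toEmbedding ?_
  rintro _ ⟨u, v, huv, rfl⟩
  exact ⟨φ u, φ v, φ.toHom.map_adj huv, Finset.map_insert φ.toEmbedding u {v}⟩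

/-- The order `σ` read backwards. -/
def reversePerm (σ : VertexPerm V) : VertexPerm V :=
  σ.trans Fin.revPerm

theorem reversePerm_lt_iff {σ : VertexPerm V} {v w : V} :
    reversePerm σ v < reversePerm σ w ↔ σ w < σ v :=
  Fin.rev_lt_rev

theorem Separates.reversePerm {σ : VertexPerm V} {A B : Finset V} (h : Separates σ A B) :
    Separates (reversePerm σ) A B :=
  h.symm.imp (fun hBA a ha b hb => reversePerm_lt_iff.2 (hBA b hb a ha))
    fun hAB b hb a ha => reversePerm_lt_iff.2 (hAB a ha b hb)

theorem IsPairwiseSuitable.exists_strictMonoOn {α : Type*} [Preorder α] {E : Set (Finset V)}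
    {F : Finset (VertexPerm V)} (hF : IsPairwiseSuitable F E) {u : α → V} {T : Set α}
    (hu : ∀ σ ∈ F, StrictMonoOn (σ ∘ u) T ∨ StrictAntiOn (σ ∘ u) T) :
    ∃ F' : Finset (VertexPerm V), IsPairwiseSuitable F' E ∧ F'.card ≤ F.card ∧
      ∀ σ ∈ F', StrictMonoOn (σ ∘ u) T := by
  classical
  let orient : VertexPerm V → VertexPerm V := fun σ =>
    if StrictMonoOn (σ ∘ u) T then σ else reversePerm σ
  refine ⟨F.image orient, fun e he f hf hne hdisj => ?_, Finset.card_image_le, fun τ hτ => ?_⟩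
  · obtain ⟨σ, hσ, hsep⟩ := hF e he f hf hne hdisj
    refine ⟨orient σ, Finset.mem_image_of_mem _ hσ, ?_⟩
    by_cases hmono : StrictMonoOn (σ ∘ u) T
    · rwa [show orient σ = σ from if_pos hmono]
    · rw [show orient σ = reversePerm σ from if_neg hmono]
      exact hsep.reversePerm
  · obtain ⟨σ, hσ, rfl⟩ := Finset.mem_image.1 hτ
    by_cases hmono : StrictMonoOn (σ ∘ u) T
    · rwa [show orient σ = σ from if_pos hmono]
    · rw [show orient σ = reversePerm σ from if_neg hmono]
      exact fun i hi j hj hij =>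
        reversePerm_lt_iff.2 ((hu σ hσ).resolve_left hmono hi hj hij)

theorem Separates.precedes_of_lt {σ : VertexPerm V} {A B : Finset V} (h : Separates σ A B)
    {a b : V} (ha : a ∈ A) (hb : b ∈ B) (hab : σ a < σ b) : Precedes σ A B :=
  h.resolve_right fun hBA => (hBA b hb a ha).asymm hab

end VertexOrders

/-! ### The lower bound -/

section ErdosSzekeres

variable {α β : Type*}

theorem exists_strictMono_fin_of_length_lt [Preorder α] {m : ℕ}
    (h : ∀ p : LTSeries α, p.length < m) : ∃ l : α → Fin m, StrictMono l := by
  have hlt (x : α) : Order.height x < m := by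
    by_contra! hle
    obtain ⟨p, -, hp⟩ := Order.exists_series_of_le_height x hle
    exact (h p).ne hp
  have hcoe (x : α) : ((Order.height x).toNat : ℕ∞) = Order.height x :=
    ENat.natCast_toNat (hlt x).ne_top
  refine ⟨fun x => ⟨(Order.height x).toNat, by exact_mod_cast (hcoe x).trans_lt (hlt x)⟩,
    fun x y hxy => ?_⟩
  have := Order.height_strictMono hxy ((hlt x).trans (ENat.natCast_lt_top m))
  rw [← hcoe x, ← hcoe y] at this
  exact Fin.mk_lt_mk.2 (by exact_mod_cast this)

variable [LinearOrder α] [LinearOrder β] {f : α → β} {S : Finset α} {m : ℕ}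

theorem exists_label_of_card_strictMonoOn_le (hf : Set.InjOn f S)
    (h : ∀ T ⊆ S, StrictMonoOn f T → T.card ≤ m) :
    ∃ l : S → Fin m, ∀ x y : S, x < y → f x < f y → l x < l y := by
  classical
  let G : Set (α × β) := {p | p.1 ∈ S ∧ f p.1 = p.2}
  have hlt {p q : G} (hpq : p < q) : p.1.1 < q.1.1 ∧ f p.1.1 < f q.1.1 := by
    have hle : p.1.1 ≤ q.1.1 ∧ f p.1.1 ≤ f q.1.1 := by
      rw [p.2.2, q.2.2]
      exact hpq.le
    have hne : p.1.1 ≠ q.1.1 := fun h =>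
      hpq.ne (Subtype.ext (Prod.ext h (by rw [← p.2.2, ← q.2.2, h])))
    exact ⟨hle.1.lt_of_ne hne, hle.2.lt_of_ne (hf.ne p.2.1 q.2.1 hne)⟩
  have hseries (p : LTSeries G) : p.length < m := by
    let q : Fin (p.length + 1) → α := fun i => (p i).1.1
    have hq : StrictMono q := fun i j hij => (hlt (p.strictMono hij)).1
    have hmono : StrictMonoOn f (Finset.univ.image q) := by
      rw [Finset.coe_image, Finset.coe_univ, Set.image_univ]
      rintro _ ⟨i, rfl⟩ _ ⟨j, rfl⟩ hij
      exact (hlt (p.strictMono (hq.lt_iff_lt.1 hij))).2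
    have hcard := h _ (Finset.image_subset_iff.2 fun i _ => (p i).2.1) hmono
    rwa [Finset.card_image_of_injective _ hq.injective, Finset.card_fin] at hcard
  obtain ⟨l, hl⟩ := exists_strictMono_fin_of_length_lt hseries
  exact ⟨fun x => l ⟨(x, f x), x.2, rfl⟩, fun x y hxy hf =>
    hl (Prod.mk_lt_mk_of_lt_of_le hxy hf.le)⟩

theorem erdos_szekeres (hf : Set.InjOn f S) (hm : m ^ 2 < S.card) :
    ∃ T ⊆ S, m < T.card ∧ (StrictMonoOn f T ∨ StrictAntiOn f T) := by
  by_contra! hcon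
  obtain ⟨incr, hincr⟩ := exists_label_of_card_strictMonoOn_le hf (m := m)
    fun T hT hmono => le_of_not_gt fun hlt => (hcon T hT hlt).1 hmono
  obtain ⟨decr, hdecr⟩ := exists_label_of_card_strictMonoOn_le
    (OrderDual.toDual.injective.comp_injOn hf) (m := m) fun T hT hmono => le_of_not_gt fun hlt =>
      (hcon T hT hlt).2 (strictMonoOn_toDual_comp_iff.1 hmono)
  have hinj : Function.Injective fun x => (incr x, decr x) := by
    refine .of_lt_imp_ne fun x y hxy heq => ?_
    obtain ⟨hi, hd⟩ := Prod.mk.inj heq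
    rcases lt_trichotomy (f x) (f y) with h | h | h
    · exact (hincr x y hxy h).ne hi
    · exact hxy.ne (Subtype.ext (hf x.2 y.2 h))
    · exact (hdecr x y hxy h).ne hd
  have hcard := Fintype.card_le_of_injective _ hinj
  simp only [Fintype.card_coe, Fintype.card_prod, Fintype.card_fin] at hcard
  exact hm.not_ge (hcard.trans_eq (sq m).symm)

theorem exists_subset_forall_strictMonoOn_or_strictAntiOn {ι : Type*} (s : Finset ι)
    (f : ι → α → β) (hf : ∀ p ∈ s, Set.InjOn (f p) S) (hS : m ^ 2 ^ s.card < S.card) :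
    ∃ T ⊆ S, m < T.card ∧ ∀ p ∈ s, StrictMonoOn (f p) T ∨ StrictAntiOn (f p) T := by
  classical
  induction s using Finset.induction_on generalizing S with
  | empty => exact ⟨S, subset_rfl, by simpa using hS, by simp⟩
  | insert p s hp ih =>
    rw [Finset.card_insert_of_notMem hp, pow_succ, pow_mul] at hS
    obtain ⟨T, hTS, hT, hTp⟩ := erdos_szekeres (hf p (Finset.mem_insert_self p s)) hS
    obtain ⟨U, hUT, hU, hUs⟩ :=
      ih (fun q hq => (hf q (Finset.mem_insert_of_mem hq)).mono (Finset.coe_subset.2 hTS)) hT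
    refine ⟨U, hUT.trans hTS, hU, Finset.forall_mem_insert _ _ _ |>.2 ⟨?_, hUs⟩⟩
    have hsub : (U : Set α) ⊆ T := Finset.coe_subset.2 hUT
    exact hTp.imp (·.mono hsub) (·.mono hsub)

end ErdosSzekeres

theorem card_le_two_pow_of_forall_ne {α γ : Type*} [LinearOrder α] [Fintype α] [Fintype γ]
    {R : α → α → γ} (hR : ∀ i j k, i < j → j < k → R i j ≠ R j k) :
    Fintype.card α ≤ 2 ^ Fintype.card γ := by
  classical
  let incoming : α → Set γ := fun j => {c | ∃ i < j, R i j = c}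
  have hinj : Function.Injective incoming := by
    refine .of_lt_imp_ne fun j k hjk heq => ?_
    have hmem : R j k ∈ incoming j := heq ▸ ⟨j, hjk, rfl⟩
    obtain ⟨i, hij, hne⟩ := hmem
    exact hR i j k hij hjk hne
  simpa using Fintype.card_le_of_injective incoming hinj

section Subdivision

/-- The full subdivision `G^{1/2}` of a graph, in which every edge of `G` is replaced by a path of
length two: its vertices are the vertices and the edges of `G`, and adjacency is incidence. -/
def fullSubdivision {V : Type*} (G : SimpleGraph V) : SimpleGraph (V ⊕ G.edgeSet) :=
  SimpleGraph.fromRel fun x y => ∃ v e, x = Sum.inl v ∧ y = Sum.inr e ∧ v ∈ e.1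

theorem fullSubdivision_adj_inl_inr {V : Type*} {G : SimpleGraph V} {v : V} {e : G.edgeSet} :
    (fullSubdivision G).Adj (Sum.inl v) (Sum.inr e) ↔ v ∈ e.1 := by
  simp [fullSubdivision]

theorem IsPairwiseSuitable.exists_separates_of_incident {V : Type*} [DecidableEq V]
    {G : SimpleGraph V} [Fintype (V ⊕ G.edgeSet)] {F : Finset (VertexPerm (V ⊕ G.edgeSet))}
    (hF : IsPairwiseSuitable F (graphEdges (fullSubdivision G))) {v w : V} {e f : G.edgeSet}
    (hv : v ∈ e.1) (hw : w ∈ f.1) (hvw : v ≠ w) (hef : e ≠ f) :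
    ∃ σ ∈ F, Separates σ {Sum.inl v, Sum.inr e} {Sum.inl w, Sum.inr f} := by
  refine hF _ ⟨_, _, fullSubdivision_adj_inl_inr.2 hv, rfl⟩
    _ ⟨_, _, fullSubdivision_adj_inl_inr.2 hw, rfl⟩ (fun heq => ?_) ?_
  · have hmem : Sum.inl v ∈ ({Sum.inl w, Sum.inr f} : Finset (V ⊕ G.edgeSet)) := by simp [← heq]
    simp [hvw] at hmem
  · simp [hvw.symm, hef.symm]

variable {α : Type*} [Fintype α] [DecidableEq α]

theorem le_two_pow_two_pow_card_of_strictMono {N : ℕ}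
    {F : Finset (VertexPerm (α ⊕ (⊤ : SimpleGraph α).edgeSet))}
    (hF : IsPairwiseSuitable F (graphEdges (fullSubdivision ⊤))) (c : Fin (N + 1) ↪ α)
    (hc : ∀ σ ∈ F, StrictMono (σ ∘ Sum.inl ∘ c)) :
    N ≤ 2 ^ 2 ^ F.card := by
  classical
  let edge : ∀ i j : Fin (N + 1), i ≠ j → (⊤ : SimpleGraph α).edgeSet :=
    fun i j h => ⟨s(c i, c j), c.injective.ne h⟩
  let R : Fin N → Fin N → Set F := fun i j =>
    {σ | ∃ h : i.castSucc ≠ j.succ,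
      σ.1 (Sum.inl (c j.castSucc)) < σ.1 (Sum.inr (edge i.castSucc j.succ h))}
  have hR : ∀ i j k, i < j → j < k → R i j ≠ R j k := by
    intro i j k hij hjk heq
    have hij' : i.castSucc ≠ j.succ := (Fin.castSucc_lt_succ_iff.2 hij.le).ne
    have hjk' : j.castSucc ≠ k.succ := (Fin.castSucc_lt_succ_iff.2 hjk.le).ne
    obtain ⟨σ, hσ, hsep⟩ := hF.exists_separates_of_incident
      (v := c j.castSucc) (w := c j.succ) (e := edge _ _ hjk') (f := edge _ _ hij')
      (by simp [edge]) (by simp [edge]) (by simp [Fin.ext_iff]) (by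
        refine fun h => ?_
        have : c j.castSucc ∈ (edge _ _ hij').1 := h ▸ Sym2.mem_mk_left _ _
        simp [edge, Fin.ext_iff, hij.ne', Fin.val_inj] at this)
    have hprec := hsep.precedes_of_lt (a := Sum.inl (c j.castSucc)) (b := Sum.inl (c j.succ))
      (by simp) (by simp) (hc σ hσ j.castSucc_lt_succ)
    have hmem : (⟨σ, hσ⟩ : F) ∈ R i j := ⟨hij', hprec _ (by simp) _ (by simp)⟩
    rw [heq] at hmem
    obtain ⟨_, hk⟩ := hmem
    have hlt : σ (Sum.inl (c k.castSucc)) < σ (Sum.inl (c j.succ)) :=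
      hk.trans (hprec _ (by simp) _ (by simp))
    exact hlt.not_ge ((hc σ hσ).monotone (Fin.succ_le_castSucc_iff.2 hjk))
  simpa using card_le_two_pow_of_forall_ne hR

theorem card_le_of_isPairwiseSuitable_subdivision {n : ℕ}
    {F : Finset (VertexPerm (Fin n ⊕ (⊤ : SimpleGraph (Fin n)).edgeSet))}
    (hF : IsPairwiseSuitable F (graphEdges (fullSubdivision ⊤))) :
    n ≤ (2 ^ 2 ^ F.card + 1) ^ 2 ^ F.card := by
  by_contra! hn
  obtain ⟨T, -, hT, hmono⟩ := exists_subset_forall_strictMonoOn_or_strictAntiOn F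
    (fun σ => σ ∘ Sum.inl) (S := Finset.univ) (m := 2 ^ 2 ^ F.card + 1)
    (fun σ _ => (σ.injective.comp Sum.inl_injective).injOn) (by simpa using hn)
  obtain ⟨F', hF', hcard, hmono'⟩ := hF.exists_strictMonoOn hmono
  obtain ⟨N, hN⟩ := Nat.exists_eq_add_of_lt hT
  let c : Fin (2 ^ 2 ^ F.card + 1 + N + 1) ↪o Fin n := T.orderEmbOfFin hN
  have hle := le_two_pow_two_pow_card_of_strictMono hF' c.toEmbedding fun σ hσ i j hij =>
    hmono' σ hσ (T.orderEmbOfFin_mem hN i) (T.orderEmbOfFin_mem hN j) (c.strictMono hij)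
  have hpow : 2 ^ 2 ^ F'.card ≤ 2 ^ 2 ^ F.card := by gcongr <;> norm_num
  lia

theorem le_two_pow_two_pow_separationDimension_fullSubdivision_top (n : ℕ) :
    n ≤ 2 ^ 2 ^ (2 * separationDimension
      (graphEdges (fullSubdivision (⊤ : SimpleGraph (Fin n)))) + 1) := by
  obtain ⟨F, hF, hcard⟩ := exists_isPairwiseSuitable_card_eq_separationDimension
    (graphEdges (fullSubdivision (⊤ : SimpleGraph (Fin n))))
  rw [← hcard]
  calc n ≤ (2 ^ 2 ^ F.card + 1) ^ 2 ^ F.card := card_le_of_isPairwiseSuitable_subdivision hF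
    _ ≤ (2 ^ (2 ^ F.card * 2)) ^ 2 ^ F.card := by
      gcongr
      have : 2 ≤ 2 ^ 2 ^ F.card := Nat.le_self_pow (by positivity) 2
      rw [pow_mul]
      nlinarith
    _ = 2 ^ 2 ^ (2 * F.card + 1) := by
      rw [← pow_mul]
      ring_nf

end Subdivision

theorem fullSubdivision_top_isContained_hypercube (d : ℕ) :
    (fullSubdivision (⊤ : SimpleGraph (Fin d))).IsContained (hypercube d) := by
  classical
  let φ : Fin d ⊕ (⊤ : SimpleGraph (Fin d)).edgeSet → Fin d → Bool :=
    Sum.elim (fun i x => decide (x = i)) fun e x => decide (x ∈ e.1)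
  have hadj {i : Fin d} {e : (⊤ : SimpleGraph (Fin d)).edgeSet} (hi : i ∈ e.1) :
      (hypercube d).Adj (φ (Sum.inl i)) (φ (Sum.inr e)) := by
    obtain ⟨e, he⟩ := e
    obtain ⟨j, rfl⟩ := Sym2.mem_iff_exists.1 hi
    have hij : i ≠ j := he
    refine ⟨j, by simp [φ, hij.symm], fun x hx => ?_⟩
    by_contra hxj
    simp [φ, hxj] at hx
  have hne (i : Fin d) (e : (⊤ : SimpleGraph (Fin d)).edgeSet) : φ (Sum.inl i) ≠ φ (Sum.inr e) := by
    intro h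
    have hmem (x : Fin d) : x = i ↔ x ∈ e.1 := by simpa [φ] using congrFun h x
    obtain ⟨j, hj⟩ := Sym2.mem_iff_exists.1 ((hmem i).1 rfl)
    have hij : i ≠ j := by
      have := e.2
      rwa [hj] at this
    exact hij ((hmem j).2 (hj ▸ Sym2.mem_mk_right i j)).symm
  refine ⟨⟨φ, ?_⟩, ?_⟩
  · rintro (i | e) (j | f) h
    · simp [fullSubdivision] at h
    · exact hadj (fullSubdivision_adj_inl_inr.1 h)
    · exact (hadj (fullSubdivision_adj_inl_inr.1 h.symm)).symm
    · simp [fullSubdivision] at h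
  · rintro (i | e) (j | f) h
    · simpa [φ] using congrFun h i
    · exact absurd h (hne i f)
    · exact absurd h.symm (hne j e)
    · exact congrArg Sum.inr (Subtype.ext (Sym2.ext fun x => by simpa [φ] using congrFun h x))

theorem le_two_pow_two_pow_separationDimension_hypercube (d : ℕ) :
    d ≤ 2 ^ 2 ^ (2 * separationDimension (graphEdges (hypercube d)) + 1) :=
  (le_two_pow_two_pow_separationDimension_fullSubdivision_top d).trans <| by
    gcongr
    · norm_num
    · norm_num
    · exact separationDimension_graphEdges_le_of_isContained
        (fullSubdivision_top_isContained_hypercube d)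

theorem half_floor_logb_logb_sub_one_le {n k : ℕ} (hn : 3 ≤ n) (h : n ≤ 2 ^ 2 ^ (2 * k + 1)) :
    (1 / 2 : ℝ) * (⌊Real.logb 2 (Real.logb 2 ((n : ℝ) - 1))⌋ : ℝ) ≤ k := by
  have hn' : (3 : ℝ) ≤ n := by exact_mod_cast hn
  have hlog : 0 < Real.logb 2 ((n : ℝ) - 1) := Real.logb_pos (by norm_num) (by linarith)
  have hlt : Real.logb 2 (Real.logb 2 ((n : ℝ) - 1)) < (2 * k + 1 : ℕ) := by
    rw [Real.logb_lt_iff_lt_rpow one_lt_two hlog, Real.rpow_natCast,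
      Real.logb_lt_iff_lt_rpow one_lt_two (by linarith)]
    calc (n : ℝ) - 1 < n := sub_one_lt _
      _ ≤ ((2 ^ 2 ^ (2 * k + 1) : ℕ) : ℝ) := by exact_mod_cast h
      _ = 2 ^ (2 ^ (2 * k + 1) : ℝ) := by
        exact_mod_cast (Real.rpow_natCast 2 (2 ^ (2 * k + 1))).symm
  have hfloor : ⌊Real.logb 2 (Real.logb 2 ((n : ℝ) - 1))⌋ ≤ 2 * (k : ℤ) := by
    have : ⌊Real.logb 2 (Real.logb 2 ((n : ℝ) - 1))⌋ < ((2 * k + 1 : ℕ) : ℤ) :=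
      Int.floor_lt.2 (by exact_mod_cast hlt)
    lia
  have : (⌊Real.logb 2 (Real.logb 2 ((n : ℝ) - 1))⌋ : ℝ) ≤ 2 * k := by exact_mod_cast hfloor
  linarith

/-! ### Three-suitable orders and the upper bound -/

section Lexicographic

variable {κ β : Type*} [LinearOrder κ] {x x' y y' : κ → β}

theorem exists_first_ne [WellFoundedLT κ] (h : x ≠ y) :
    ∃ n, x n ≠ y n ∧ ∀ t < n, x t = y t := by
  obtain ⟨n, hn, hmin⟩ := wellFounded_lt.has_min {n | x n ≠ y n} (Function.ne_iff.1 h)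
  exact ⟨n, hn, fun t ht => not_not.1 fun hne => hmin t hne ht⟩

theorem toLex_lt_toLex_of_eqOn_Iic [LT β] {n : κ} (hx : Set.EqOn x x' (Set.Iic n))
    (hy : Set.EqOn y y' (Set.Iic n)) (hne : x n ≠ y n) (h : toLex x < toLex y) :
    toLex x' < toLex y' := by
  obtain ⟨r, heq, hlt⟩ := h
  have hrn : r ≤ n := le_of_not_gt fun hnr => hne (heq n hnr)
  refine ⟨r, fun t ht => ?_, ?_⟩
  · exact (hx (ht.le.trans hrn)).symm.trans ((heq t ht).trans (hy (ht.le.trans hrn)))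
  · change x' r < y' r
    rw [← hx hrn, ← hy hrn]
    exact hlt

end Lexicographic

section ThreeSuitable

/-- A family of orders of `V` is `3`-suitable (Dushnik) if any element `l` precedes any two other
elements `i` and `j` in some member of the family. -/
def IsThreeSuitable {V ι : Type*} [Fintype V] (ρ : ι → VertexPerm V) : Prop :=
  ∀ l i j, l ≠ i → l ≠ j → ∃ p, ρ p l < ρ p i ∧ ρ p l < ρ p j

/-- A family of binary strings is `2`-universal (a covering array of strength two) if every string
agrees with some member of the family at any two given positions. The positions may coincide, so
that a single position sees both bits. -/
def IsTwoUniversal {ι κ : Type*} (a : ι → κ → Bool) : Prop :=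
  ∀ (c : κ → Bool) (n n' : κ), ∃ p, a p n = c n ∧ a p n' = c n'

theorem exists_isTwoUniversal_powersetCard (α : Type*) [Fintype α] {r : ℕ}
    (h : 2 * r < Fintype.card α) :
    ∃ a : Option α → {A : Finset α // A.card = r} → Bool, IsTwoUniversal a := by
  classical
  refine ⟨fun p A => p.elim true fun x => decide (x ∈ A.1), fun c A B => ?_⟩
  have hdiff {A B : {A : Finset α // A.card = r}} (hAB : A ≠ B) : ∃ x ∈ A.1, x ∉ B.1 :=
    Finset.not_subset.1 fun hsub =>
      hAB (Subtype.ext (Finset.eq_of_subset_of_card_le hsub (B.2.trans A.2.symm).le))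
  have hout : ∃ x, x ∉ A.1 ∧ x ∉ B.1 := by
    have hcard : (A.1 ∪ B.1).card < Fintype.card α :=
      (Finset.card_union_le A.1 B.1).trans_lt (by rw [A.2, B.2]; lia)
    simpa using Finset.exists_mem_notMem_of_card_lt_card (s := A.1 ∪ B.1) (t := Finset.univ) hcard
  -- The `r`-sets form an antichain no two of which cover `α`, so the points of `α` realise every
  -- pair of bits except `(true, true)`, which the constant string supplies.
  cases hA : c A <;> cases hB : c B
  · obtain ⟨x, hxA, hxB⟩ := hout
    exact ⟨some x, by simp [hxA], by simp [hxB]⟩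
  · obtain ⟨x, hxB, hxA⟩ := hdiff (A := B) (B := A) (by rintro rfl; simp_all)
    exact ⟨some x, by simp [hxA], by simp [hxB]⟩
  · obtain ⟨x, hxA, hxB⟩ := hdiff (A := A) (B := B) (by rintro rfl; simp_all)
    exact ⟨some x, by simp [hxA], by simp [hxB]⟩
  · exact ⟨none, rfl, rfl⟩

variable {V ι κ : Type*} [Fintype V] [Fintype κ]

theorem IsTwoUniversal.exists_isThreeSuitable {a : ι → κ → Bool} (ha : IsTwoUniversal a)
    (hV : Fintype.card V ≤ 2 ^ Fintype.card κ) :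
    ∃ ρ : ι → VertexPerm V, IsThreeSuitable ρ := by
  classical
  let : LinearOrder κ := LinearOrder.lift' (Fintype.equivFin κ) (Fintype.equivFin κ).injective
  obtain ⟨φ⟩ : Nonempty (V ↪ (κ → Bool)) :=
    Function.Embedding.nonempty_of_card_le (by simpa using hV)
  have hinj (p : ι) : Function.Injective fun v => toLex fun n => xor (φ v n) (a p n) :=
    fun v w hvw => φ.injective <| funext fun n =>
      by simpa using congrFun (toLex.injective hvw) n
  choose ρ hρ using fun p => exists_vertexPerm_lt_iff (hinj p)
  have hprecedes {v w : V} {n : κ} {p : ι} (hne : φ v n ≠ φ w n)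
      (heq : ∀ t < n, φ v t = φ w t) (hp : a p n = φ v n) : ρ p v < ρ p w := by
    refine (hρ p v w).2 ⟨n, fun t ht => congrArg (xor · (a p t)) (heq t ht), ?_⟩
    change xor (φ v n) (a p n) < xor (φ w n) (a p n)
    rw [hp]
    revert hne
    cases φ v n <;> cases φ w n <;> decide
  refine ⟨ρ, fun l i j hli hlj => ?_⟩
  obtain ⟨n, hn, hbefore⟩ := exists_first_ne (φ.injective.ne hli)
  obtain ⟨n', hn', hbefore'⟩ := exists_first_ne (φ.injective.ne hlj)
  obtain ⟨p, hp, hp'⟩ := ha (φ l) n n'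
  exact ⟨p, hprecedes hn hbefore hp, hprecedes hn' hbefore' hp'⟩

theorem exists_vertexPerm_separates_of_ne {β : Type*} [DecidableEq V] [Fintype β]
    [LinearOrder β] (ρ : VertexPerm V) :
    ∃ σ : VertexPerm (V → β), ∀ (A B : Finset (V → β)) (u v : V → β) (l : V), u l ≠ v l →
      (∀ a ∈ A, ∀ x, ρ x ≤ ρ l → a x = u x) → (∀ b ∈ B, ∀ x, ρ x ≤ ρ l → b x = v x) →
      Separates σ A B := by
  have hinj : Function.Injective fun w : V → β => toLex (w ∘ ρ.symm) :=
    toLex.injective.comp ρ.symm.surjective.injective_comp_right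
  obtain ⟨σ, hσ⟩ := exists_vertexPerm_lt_iff hinj
  refine ⟨σ, fun A B u v l hl hA hB => ?_⟩
  have hprefix {C : Finset (V → β)} {w : V → β} (hC : ∀ c ∈ C, ∀ x, ρ x ≤ ρ l → c x = w x)
      {c : V → β} (hc : c ∈ C) : Set.EqOn (w ∘ ρ.symm) (c ∘ ρ.symm) (Set.Iic (ρ l)) :=
    fun t ht => (hC c hc _ (by simpa using ht)).symm
  have hl' : (u ∘ ρ.symm) (ρ l) ≠ (v ∘ ρ.symm) (ρ l) := by simpa using hl
  rcases lt_or_gt_of_ne (hinj.ne (ne_of_apply_ne (· l) hl)) with huv | hvu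
  · exact Or.inl fun a ha b hb => (hσ a b).2 <|
      toLex_lt_toLex_of_eqOn_Iic (hprefix hA ha) (hprefix hB hb) hl' huv
  · exact Or.inr fun b hb a ha => (hσ b a).2 <|
      toLex_lt_toLex_of_eqOn_Iic (hprefix hB hb) (hprefix hA ha) hl'.symm hvu

end ThreeSuitable

section Hypercube

variable {d : ℕ}

theorem exists_mem_iff_of_mem_graphEdges_hypercube {e : Finset (Fin d → Bool)}
    (he : e ∈ graphEdges (hypercube d)) :
    ∃ (i : Fin d) (u : Fin d → Bool), ∀ w, w ∈ e ↔ ∀ x ≠ i, w x = u x := by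
  obtain ⟨u, u', ⟨i, hi, huniq⟩, rfl⟩ := he
  have hu' : ∀ x ≠ i, u' x = u x := fun x hx => not_not.1 fun h => hx (huniq x (Ne.symm h))
  refine ⟨i, u, fun w => ⟨fun hw => ?_, fun hw => ?_⟩⟩
  · rcases (by simpa using hw : w = u ∨ w = u') with rfl | rfl
    · exact fun _ _ => rfl
    · exact hu'
  · have hwi : w i = u i ∨ w i = u' i := by
      revert hi
      cases w i <;> cases u i <;> cases u' i <;> decide
    have hext {v : Fin d → Bool} (hv : ∀ x ≠ i, v x = u x) (hwv : w i = v i) : w = v :=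
      funext fun x => by
        by_cases hx : x = i
        · rw [hx, hwv]
        · rw [hw x hx, hv x hx]
    simpa using hwi.imp (hext fun _ _ => rfl) (hext hu')

theorem IsThreeSuitable.separationDimension_hypercube_le {ι : Type*} [Fintype ι]
    {ρ : ι → VertexPerm (Fin d)} (hρ : IsThreeSuitable ρ) :
    separationDimension (graphEdges (hypercube d)) ≤ Fintype.card ι := by
  classical
  choose σ hσ using fun p => exists_vertexPerm_separates_of_ne (β := Bool) (ρ p)
  have hsuitable : IsPairwiseSuitable (Finset.univ.image σ) (graphEdges (hypercube d)) := by
    intro e he f hf _ hdisj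
    obtain ⟨i, u, hu⟩ := exists_mem_iff_of_mem_graphEdges_hypercube he
    obtain ⟨j, v, hv⟩ := exists_mem_iff_of_mem_graphEdges_hypercube hf
    obtain ⟨l, hlj, hl⟩ : ∃ l ≠ j, Function.update u i (v i) l ≠ v l := by
      have hmem : Function.update u i (v i) ∈ e :=
        (hu _).2 fun x hx => Function.update_of_ne hx _ _
      simpa [hv] using Finset.disjoint_left.1 hdisj hmem
    have hli : l ≠ i := by
      rintro rfl
      simp at hl
    rw [Function.update_of_ne hli] at hl
    obtain ⟨p, hpi, hpj⟩ := hρ l i j hli hlj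
    refine ⟨σ p, Finset.mem_image_of_mem _ (Finset.mem_univ p), hσ p e f u v l hl ?_ ?_⟩
    · exact fun a ha x hx => (hu a).1 ha x fun h => (h ▸ hx).not_gt hpi
    · exact fun b hb x hx => (hv b).1 hb x fun h => (h ▸ hx).not_gt hpj
  exact (separationDimension_le_card hsuitable).trans Finset.card_image_le

theorem separationDimension_hypercube_le_of_le_two_pow_choose {m r : ℕ} (h : 2 * r < m)
    (hd : d ≤ 2 ^ m.choose r) :
    separationDimension (graphEdges (hypercube d)) ≤ m + 1 := by
  obtain ⟨a, ha⟩ := exists_isTwoUniversal_powersetCard (Fin m) (r := r) (by simpa using h)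
  obtain ⟨ρ, hρ⟩ := ha.exists_isThreeSuitable (V := Fin d) (by simpa using hd)
  simpa using hρ.separationDimension_hypercube_le

end Hypercube

/-! ### Asymptotics -/

section Choose

theorem two_mul_sixteen_pow_le_centralBinom_sq (n : ℕ) :
    2 * (16 : ℝ) ^ n ≤ (n.centralBinom : ℝ) ^ 2 * (2 * n + 1) * Real.pi := by
  have hfactorial : (n.centralBinom : ℝ) * (n.factorial : ℝ) ^ 2 = ((2 * n).factorial : ℝ) := by
    have := Nat.add_choose_mul_factorial_mul_factorial n n
    rw [← two_mul, ← Nat.centralBinom_eq_two_mul_choose] at this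
    rw [← this]
    push_cast
    ring
  have hpos : (0 : ℝ) < n.centralBinom := by exact_mod_cast n.centralBinom_pos
  have hWallis := Real.Wallis.W_le n
  rw [Real.Wallis.W_eq_factorial_ratio, ← hfactorial, div_le_iff₀ (by positivity), pow_mul]
    at hWallis
  norm_num at hWallis
  refine le_of_mul_le_mul_right ?_ (show (0 : ℝ) < (n.factorial : ℝ) ^ 4 by positivity)
  linarith

theorem four_pow_le_choose_sq_of_odd (n : ℕ) :
    (4 : ℝ) ^ (2 * n + 2) ≤
      ((2 * n + 1).choose n : ℝ) ^ 2 * (2 * Real.pi * (2 * n + 3)) := by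
  have hB : ((n + 1).centralBinom : ℝ) = 2 * ((2 * n + 1).choose n : ℝ) := by
    rw [Nat.centralBinom_eq_two_mul_choose, mul_add_one, Nat.choose_succ_succ',
      Nat.choose_symm_half]
    push_cast
    ring
  have h := two_mul_sixteen_pow_le_centralBinom_sq (n + 1)
  rw [hB] at h
  rw [show 2 * n + 2 = 2 * (n + 1) by ring, pow_mul]
  norm_num at h ⊢
  linarith

theorem four_pow_mul_sq_le_choose_sq_of_even (n : ℕ) :
    (4 : ℝ) ^ (2 * n + 3) * (2 * n + 2) ^ 2 ≤
      ((2 * n + 2).choose n : ℝ) ^ 2 * (2 * Real.pi * (2 * n + 3) * (2 * n + 4) ^ 2) := by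
  have hB : ((2 * n + 2).choose n : ℝ) * (n + 2) = (n + 1).centralBinom * (n + 1) := by
    have := Nat.choose_succ_right_eq (2 * n + 2) n
    rw [show 2 * n + 2 - n = n + 2 by lia] at this
    rw [Nat.centralBinom_eq_two_mul_choose]
    exact_mod_cast this.symm
  have h := two_mul_sixteen_pow_le_centralBinom_sq (n + 1)
  push_cast at h
  calc (4 : ℝ) ^ (2 * n + 3) * (2 * n + 2) ^ 2
      = 8 * (n + 1) ^ 2 * (2 * 16 ^ (n + 1)) := by
        rw [show 2 * n + 3 = 2 * (n + 1) + 1 by ring, pow_succ, pow_mul]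
        norm_num
        ring
    _ ≤ 8 * (n + 1) ^ 2 *
        ((n + 1).centralBinom ^ 2 * (2 * (n + 1) + 1) * Real.pi) := by gcongr
    _ = 8 * ((n + 1).centralBinom * (n + 1)) ^ 2 * (2 * (n + 1) + 1) * Real.pi := by ring
    _ = _ := by
      rw [← hB]
      ring

theorem four_pow_mul_sq_le_choose_sq {m : ℕ} (hm : m ≠ 0) :
    (4 : ℝ) ^ (m + 1) * (m : ℝ) ^ 2 ≤
      (m.choose ((m - 1) / 2) : ℝ) ^ 2 * (2 * Real.pi * (m + 2) ^ 3) := by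
  obtain ⟨n, rfl | rfl⟩ : ∃ n, m = 2 * n + 1 ∨ m = 2 * n + 2 := ⟨(m - 1) / 2, by lia⟩
  · rw [show (2 * n + 1 - 1) / 2 = n by lia]
    push_cast
    calc (4 : ℝ) ^ (2 * n + 1 + 1) * (2 * n + 1) ^ 2
        ≤ ((2 * n + 1).choose n : ℝ) ^ 2 * (2 * Real.pi * (2 * n + 3)) * (2 * n + 3) ^ 2 := by
          gcongr
          · exact four_pow_le_choose_sq_of_odd n
          · norm_num
      _ = _ := by ring
  · rw [show (2 * n + 2 - 1) / 2 = n by lia]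
    push_cast
    calc (4 : ℝ) ^ (2 * n + 2 + 1) * (2 * n + 2) ^ 2
        ≤ ((2 * n + 2).choose n : ℝ) ^ 2 * (2 * Real.pi * (2 * n + 3) * (2 * n + 4) ^ 2) :=
          four_pow_mul_sq_le_choose_sq_of_even n
      _ ≤ ((2 * n + 2).choose n : ℝ) ^ 2 * (2 * Real.pi * (2 * n + 4) * (2 * n + 4) ^ 2) := by
          gcongr
          norm_num
      _ = _ := by ring

theorem le_logb_choose {m : ℕ} (hm : m ≠ 0) :
    (m : ℝ) + 1 + Real.logb 2 m - 3 / 2 * Real.logb 2 (m + 2)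
      - Real.logb 2 (Real.sqrt (2 * Real.pi)) ≤
    Real.logb 2 (m.choose ((m - 1) / 2)) := by
  have hC : (0 : ℝ) < m.choose ((m - 1) / 2) := by exact_mod_cast Nat.choose_pos (by lia)
  have h := Real.logb_le_logb_of_le (b := 2) one_lt_two (by positivity)
    (four_pow_mul_sq_le_choose_sq hm)
  rw [Real.logb_mul (by positivity) (by positivity), Real.logb_mul (by positivity) (by positivity),
    Real.logb_mul (by positivity) (by positivity), Real.logb_pow, Real.logb_pow, Real.logb_pow,
    Real.logb_pow, show (4 : ℝ) = 2 ^ 2 by norm_num, Real.logb_pow,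
    Real.logb_self_eq_one one_lt_two,
    ← Real.sq_sqrt (show 0 ≤ 2 * Real.pi by positivity), Real.logb_pow] at h
  push_cast at h
  linarith

end Choose

section Limits

theorem tendsto_logb_two_atTop : Tendsto (Real.logb 2) atTop atTop :=
  Real.tendsto_logb_atTop one_lt_two

theorem tendsto_logb_add_mul_logb_add_sub_logb (b a c : ℝ) :
    Tendsto (fun x : ℝ => Real.logb b (x + a * Real.logb b x + c) - Real.logb b x)
      atTop (𝓝 0) := by
  have hlog : Tendsto (fun x : ℝ => Real.logb b x / x) atTop (𝓝 0) := by
    simpa [Real.logb, div_right_comm] using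
      Real.isLittleO_log_id_atTop.tendsto_div_nhds_zero.div_const (Real.log b)
  have hratio : Tendsto (fun x : ℝ => 1 + a * (Real.logb b x / x) + c * x⁻¹) atTop (𝓝 1) := by
    simpa using (tendsto_const_nhds.add (hlog.const_mul a)).add (tendsto_inv_atTop_zero.const_mul c)
  have hlogratio := (Real.continuousAt_logb (b := b) one_ne_zero).tendsto.comp hratio
  rw [Real.logb_one] at hlogratio
  refine hlogratio.congr' ?_
  filter_upwards [eventually_gt_atTop 0, hratio.eventually (lt_mem_nhds one_pos)] with x hx hpos
  have hfactor : x + a * Real.logb b x + c = x * (1 + a * (Real.logb b x / x) + c * x⁻¹) := by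
    field_simp
  rw [hfactor, Real.logb_mul hx.ne' hpos.ne', add_sub_cancel_left, Function.comp_apply]

theorem eventually_forall_le_add_logb_sub_logb (c : ℝ) {δ : ℝ} (hδ : 0 < δ) :
    ∀ᶠ L : ℝ in atTop, ∀ x : ℝ, L + 1 / 2 * Real.logb 2 L + c + δ ≤ x + 1 →
      x < L + 1 / 2 * Real.logb 2 L + c + δ →
      L ≤ x + 1 + Real.logb 2 x - 3 / 2 * Real.logb 2 (x + 2) - c := by
  have hsmall := (tendsto_logb_add_mul_logb_add_sub_logb 2 (1 / 2) (c + δ + 2)).eventually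
    (gt_mem_nhds (show (0 : ℝ) < 2 / 3 * δ by positivity))
  filter_upwards [hsmall, eventually_gt_atTop 0,
    tendsto_logb_two_atTop.eventually_ge_atTop (2 * (1 - c - δ))] with L hL hpos hlarge x hle hlt
  have hLx : Real.logb 2 L ≤ Real.logb 2 x :=
    Real.logb_le_logb_of_le one_lt_two hpos (by linarith)
  have hxL : Real.logb 2 (x + 2) ≤ Real.logb 2 (L + 1 / 2 * Real.logb 2 L + (c + δ + 2)) :=
    Real.logb_le_logb_of_le one_lt_two (by linarith) (by linarith)
  linarith

theorem exists_tendsto_zero_forall_le_ceil {a : ℕ → ℤ} {f : ℕ → ℝ}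
    (h : ∀ δ > 0, ∀ᶠ d in atTop, a d ≤ ⌈f d + δ⌉) :
    ∃ ε : ℕ → ℝ, Tendsto ε atTop (𝓝 0) ∧ ∀ d, a d ≤ ⌈f d + ε d⌉ := by
  -- `a d ≤ ⌈f d + ε d⌉` means `a d - 1 - f d < ε d`; the second summand makes this strict.
  refine ⟨fun d => max 0 ((a d : ℝ) - 1 - f d) + 1 / ((d : ℝ) + 1), ?_, fun d => ?_⟩
  · have hmax : Tendsto (fun d => max 0 ((a d : ℝ) - 1 - f d)) atTop (𝓝 0) := by
      refine Metric.tendsto_nhds.2 fun δ hδ => ?_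
      filter_upwards [h δ hδ] with d hd
      rw [Int.le_ceil_iff] at hd
      rw [Real.dist_eq, sub_zero, abs_of_nonneg (le_max_left _ _)]
      exact max_lt hδ (by linarith)
    simpa using hmax.add tendsto_one_div_add_atTop_nhds_zero_nat
  · rw [Int.le_ceil_iff]
    have hexcess := le_max_right 0 ((a d : ℝ) - 1 - f d)
    have hpos : (0 : ℝ) < 1 / ((d : ℝ) + 1) := by positivity
    linarith

end Limits

theorem separationDimension_hypercube_le_of_logb_logb_le {d m : ℕ} (hd : 2 ≤ d) (hm : m ≠ 0)
    (h : Real.logb 2 (Real.logb 2 d) ≤ Real.logb 2 (m.choose ((m - 1) / 2))) :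
    separationDimension (graphEdges (hypercube d)) ≤ m + 1 := by
  have hd' : (1 : ℝ) < d := by exact_mod_cast hd
  have hC : (0 : ℝ) < m.choose ((m - 1) / 2) := by exact_mod_cast Nat.choose_pos (by lia)
  rw [Real.logb_le_logb one_lt_two (Real.logb_pos one_lt_two hd') hC,
    Real.logb_le_iff_le_rpow one_lt_two (by linarith), Real.rpow_natCast] at h
  exact separationDimension_hypercube_le_of_le_two_pow_choose (m := m) (r := (m - 1) / 2)
    (by lia) (by exact_mod_cast h)

theorem eventually_separationDimension_hypercube_le {δ : ℝ} (hδ : 0 < δ) :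
    ∀ᶠ d : ℕ in atTop, (separationDimension (graphEdges (hypercube d)) : ℤ) ≤
      ⌈Real.logb 2 (Real.logb 2 (d : ℝ))
        + (1 / 2 : ℝ) * Real.logb 2 (Real.logb 2 (Real.logb 2 (d : ℝ)))
        + Real.logb 2 (Real.sqrt (2 * Real.pi)) + δ⌉ := by
  have hloglog : Tendsto (fun d : ℕ => Real.logb 2 (Real.logb 2 (d : ℝ))) atTop atTop :=
    tendsto_logb_two_atTop.comp (tendsto_logb_two_atTop.comp tendsto_natCast_atTop_atTop)
  have hbound : Tendsto (fun L : ℝ => L + 1 / 2 * Real.logb 2 L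
      + Real.logb 2 (Real.sqrt (2 * Real.pi)) + δ) atTop atTop :=
    tendsto_atTop_add_const_right _ _ <| tendsto_atTop_add_const_right _ _ <|
      tendsto_id.atTop_add_atTop (tendsto_logb_two_atTop.const_mul_atTop one_half_pos)
  filter_upwards [hloglog.eventually (eventually_forall_le_add_logb_sub_logb
      (Real.logb 2 (Real.sqrt (2 * Real.pi))) hδ),
    hloglog.eventually (hbound.eventually_gt_atTop 1), eventually_ge_atTop 2] with d hineq hgt hd
  set B := Real.logb 2 (Real.logb 2 (d : ℝ))
    + (1 / 2 : ℝ) * Real.logb 2 (Real.logb 2 (Real.logb 2 (d : ℝ)))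
    + Real.logb 2 (Real.sqrt (2 * Real.pi)) + δ
  have hone_lt_ceil : 1 < ⌈B⌉ := Int.lt_ceil.2 (by exact_mod_cast hgt)
  obtain ⟨m, hceil, hm⟩ : ∃ m : ℕ, ⌈B⌉ = m + 1 ∧ m ≠ 0 :=
    ⟨(⌈B⌉ - 1).toNat, by lia, by lia⟩
  obtain ⟨hlt, hle⟩ := Int.ceil_eq_iff.1 hceil
  push_cast at hlt hle
  rw [hceil]
  exact_mod_cast separationDimension_hypercube_le_of_logb_logb_le hd hm <|
    (hineq m hle (by linarith)).trans (le_logb_choose hm)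

theorem mainTheorem12 :
    (∀ d : ℕ, 3 ≤ d →
      (1 / 2 : ℝ) * (⌊Real.logb 2 (Real.logb 2 ((d : ℝ) - 1))⌋ : ℝ) ≤
        (separationDimension (graphEdges (hypercube d)) : ℝ)) ∧
    ∃ ε : ℕ → ℝ, Tendsto ε atTop (𝓝 0) ∧
      ∀ d : ℕ, 3 ≤ d →
        (separationDimension (graphEdges (hypercube d)) : ℤ) ≤
          ⌈Real.logb 2 (Real.logb 2 (d : ℝ))
            + (1 / 2 : ℝ) * Real.logb 2 (Real.logb 2 (Real.logb 2 (d : ℝ)))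
            + Real.logb 2 (Real.sqrt (2 * Real.pi)) + ε d⌉ := by
  refine ⟨fun d hd => half_floor_logb_logb_sub_one_le hd
    (le_two_pow_two_pow_separationDimension_hypercube d), ?_⟩
  obtain ⟨ε, hε, hle⟩ := exists_tendsto_zero_forall_le_ceil fun _ hδ =>
    eventually_separationDimension_hypercube_le hδ
  exact ⟨ε, hε, fun d _ => hle d⟩
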